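/- **The calculus.** Let $\mathcal X$ (channel names $x,y,\dots$) and $\mathcal{QN}$ (stochastic names $q,\dots$) be disjoint countably infinite sets, and let $\lambda$ range over the positive reals $\mathbb R^+$ (rates). Extended terms are given by $$P ::= M \mid P|P' \mid (\nu x)P \mid (\nu q\to\lambda)P \mid A(x_1,\dots,x_n),\qquad M ::= \mathbf 0 \mid \alpha.P \mid M+M',\qquad \alpha ::= \overline{x}\langle y\rangle \mid x(y) \mid \tau \mid (\lambda) \mid (q),$$ up to alpha-conversion, where $x(y).P$ and $(\nu y)P$ bind the channel $y$ in $P$ and the stochastic binder $(\nu q\to\lambda)P$ binds $q$ in $P$. A term is *plain* if it contains no stochastic binder and no prefix $(q)$. Every constant $A$, of arity $n$, has a definition $A(x_1,\dots,x_n):=P_A$, where $P_A$ is plain, its free names are among the distinct parameters $x_1,\dots,x_n$, and recursion is weakly guarded: by replacing finitely many times an occurrence of a constant $B(\tilde y)$ by $P_B\{\tilde y/\tilde x\}$, one can turn $P_A$ into a term in which every constant occurs in the scope of a prefix. Write $(\nu\theta\to\hat\lambda)$ for any of the binders $(\nu x)$, $(\nu q\to\lambda)$. **Structural congruence** $\equiv$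 is the least congruence on extended terms such that $(\nu\theta\to\hat\lambda)P\,|\,Q\equiv(\nu\theta\to\hat\lambda)(P|Q)$ if $\theta\notin fn(Q)$; $(\nu\theta\to\hat\lambda)(\nu\theta'\to\hat\lambda')P\equiv(\nu\theta'\to\hat\lambda')(\nu\theta\to\hat\lambda)P$ if $\theta\ne\theta'$; $(\nu\theta\to\hat\lambda)\mathbf 0\equiv\mathbf 0$; $+$ and $|$ are each associative and commutative with unit $\mathbf 0$; $A(\tilde y)\equiv P_A\{\tilde y/\tilde x\}$; and $(\lambda).P+M\equiv(\nu q\to\lambda)((q).P+M)$ if $q\notin fn(M,P)$. **Labelled reductions** $P\xrightarrow{\hat q}P'$, with $\hat q\in\mathcal{QN}\cup\{\varepsilon\}$, are the least relation such that $(q).P+M\xrightarrow{q}P$; $\tau.P+M\xrightarrow{\varepsilon}P$; $(x(z).P+M)\,|\,(\overline x\langle y\rangle.Q+N)\xrightarrow{\varepsilon}P\{y/z\}\,|\,Q$; if $P\xrightarrow{\hat q}P'$, then $P|Q\xrightarrow{\hat q}P'|Q$, and $(\nu\theta\to\hat\lambda)P\xrightarrow{\hat q}(\nu\theta\to\hat\lambda)P'$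 provided $\theta\ne\hat q$; and $P\equiv Q\xrightarrow{\hat q}Q'\equiv P'$ implies $P\xrightarrow{\hat q}P'$. **Stochastic transitions.** A rate distribution $\sigma$ is a nonempty finite multiset of pairs $(\lambda,[P]_\equiv)$ of a rate and a congruence class of extended terms; $(\nu q\to\lambda)\sigma$ is obtained from $\sigma$ by replacing each element $(\lambda',[P]_\equiv)$ by $(\lambda',[(\nu q\to\lambda)P]_\equiv)$, with multiplicity. The stochastic transition relation $P\to\sigma$ is the relation defined by the following rules, which can be stratified ($\uplus$ adds multiplicities; $P\not\to$ means that $P\to\sigma$ for no $\sigma$): * if $P\to\sigma$ and $P\xrightarrow{q}P'$, then $(\nu q\to\lambda)P\to(\nu q\to\lambda)\sigma\uplus\{(\lambda,[(\nu q\to\lambda)P']_\equiv)\}$; * if $P\not\to$ and $P\xrightarrow{q}P'$, then $(\nu q\to\lambda)P\to\{(\lambda,[(\nu q\to\lambda)P']_\equiv)\}$; * if $P\equiv Q$ and $Q\to\sigma$, then $P\to\sigma$. **Proposition.** Let $P$ be a plain term. If $P\to\sigma$ and $P\to\sigma'$, then $\sigma=\sigma'$. -/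

import Mathlib

namespace MarkovPi

/-- Rates of Markovian delays: positive reals. -/
abbrev Rate : Type := {r : ℝ // 0 < r}

/-- The prefixes of the extended calculus. There are two separate sorts of names, channel names and
stochastic names, and terms are taken up to alpha-conversion by writing the names of each sort as
de Bruijn indices: `n` refers to the `n`-th enclosing binder of its sort, counted from the inside
and starting at `0`; indices that exceed the number of enclosing binders are the free names. -/
inductive Act : Type
  /-- output of the channel `y` on the channel `x` -/
  | out (x y : ℕ) : Act
  /-- input on the channel `x`; binds one channel name in the continuation -/
  | inp (x : ℕ) : Act
  | tau : Act
  /-- the Markovian delay `(r)` of rate `r` -/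
  | rate (r : Rate) : Act
  /-- the symbolic delay `(q)` for the stochastic name `q` -/
  | sto (q : ℕ) : Act

universe u

mutual
/-- Terms of the extended calculus over constants `A : K` of arity `ar A`. -/
inductive Proc {K : Type u} (ar : K → ℕ) : Type u
  | sum : GSum ar → Proc ar
  | par : Proc ar → Proc ar → Proc ar
  /-- `(ν x) P`; binds one channel name -/
  | nu : Proc ar → Proc ar
  /-- the stochastic binder `(ν q → r) P`; binds one stochastic name -/
  | snu : Rate → Proc ar → Proc ar
  /-- `A(y₁, …, yₙ)` -/
  | call (A : K) (y : Fin (ar A) → ℕ) : Proc ar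
/-- Guarded sums. -/
inductive GSum {K : Type u} (ar : K → ℕ) : Type u
  | nil : GSum ar
  | pre : Act → Proc ar → GSum ar
  | add : GSum ar → GSum ar → GSum ar
end

/-- Extension of a map of names to the scope of a binder. -/
def lift (f : ℕ → ℕ) : ℕ → ℕ
  | 0 => 0
  | n + 1 => f n + 1

/-- The exchange of the two innermost bound names. -/
def swap01 : ℕ → ℕ
  | 0 => 1
  | 1 => 0
  | n + 2 => n + 2

/-- Instantiation of the innermost bound channel name by `y`. -/
def inst (y : ℕ) : ℕ → ℕ
  | 0 => y
  | n + 1 => n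

/-- Renaming of the names occurring in a prefix. -/
def Act.ren (f g : ℕ → ℕ) : Act → Act
  | .out x y => .out (f x) (f y)
  | .inp x => .inp (f x)
  | .tau => .tau
  | .rate r => .rate r
  | .sto q => .sto (g q)

/-- The action on channel names in the continuation of a prefix: an input binds one. -/
def Act.under (f : ℕ → ℕ) : Act → (ℕ → ℕ)
  | .inp _ => lift f
  | _ => f

mutual
/-- Simultaneous capture-avoiding substitution of channel names by `f` and stochastic names
by `g`. -/
def Proc.ren {K : Type u} {ar : K → ℕ} (f g : ℕ → ℕ) : Proc ar → Proc ar
  | .sum M => .sum (M.ren f g)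
  | .par P Q => .par (P.ren f g) (Q.ren f g)
  | .nu P => .nu (P.ren (lift f) g)
  | .snu r P => .snu r (P.ren f (lift g))
  | .call A y => .call A (fun i => f (y i))
def GSum.ren {K : Type u} {ar : K → ℕ} (f g : ℕ → ℕ) : GSum ar → GSum ar
  | .nil => .nil
  | .pre a P => .pre (a.ren f g) (P.ren (a.under f) g)
  | .add M N => .add (M.ren f g) (N.ren f g)
end

/-- Weakening by one channel name: the named term seen under a binder for a channel that is not
free in it. -/
def Proc.up {K : Type u} {ar : K → ℕ} (P : Proc ar) : Proc ar := P.ren Nat.succ id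

/-- Weakening by one stochastic name. -/
def Proc.sup {K : Type u} {ar : K → ℕ} (P : Proc ar) : Proc ar := P.ren id Nat.succ

def GSum.sup {K : Type u} {ar : K → ℕ} (M : GSum ar) : GSum ar := M.ren id Nat.succ

/-- The inactive term. -/
def Proc.nil {K : Type u} {ar : K → ℕ} : Proc ar := .sum .nil

/-- A prefix of the plain calculus, i.e. one that is not of the form `(q)`. -/
def Act.IsPlain : Act → Prop
  | .sto _ => False
  | _ => True

mutual
/-- The terms of the plain calculus: no stochastic binder and no prefix `(q)`. -/
def Proc.IsPlain {K : Type u} {ar : K → ℕ} : Proc ar → Prop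
  | .sum M => M.IsPlain
  | .par P Q => P.IsPlain ∧ Q.IsPlain
  | .nu P => P.IsPlain
  | .snu _ _ => False
  | .call _ _ => True
def GSum.IsPlain {K : Type u} {ar : K → ℕ} : GSum ar → Prop
  | .nil => True
  | .pre a P => a.IsPlain ∧ P.IsPlain
  | .add M N => M.IsPlain ∧ N.IsPlain
end

/-- The free channel names of a prefix are below `n`. -/
def Act.ChanLT (n : ℕ) : Act → Prop
  | .out x y => x < n ∧ y < n
  | .inp x => x < n
  | _ => True

/-- The bound on free channel names in the continuation of a prefix. -/
def Act.bound (n : ℕ) : Act → ℕ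
  | .inp _ => n + 1
  | _ => n

mutual
/-- The free channel names of a term are among `0, …, n - 1`. -/
def Proc.ChanLT {K : Type u} {ar : K → ℕ} (n : ℕ) : Proc ar → Prop
  | .sum M => M.ChanLT n
  | .par P Q => P.ChanLT n ∧ Q.ChanLT n
  | .nu P => P.ChanLT (n + 1)
  | .snu _ P => P.ChanLT n
  | .call _ y => ∀ i, y i < n
def GSum.ChanLT {K : Type u} {ar : K → ℕ} (n : ℕ) : GSum ar → Prop
  | .nil => True
  | .pre a P => a.ChanLT n ∧ P.ChanLT (a.bound n)
  | .add M N => M.ChanLT n ∧ N.ChanLT n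
end

/-- Every constant occurs in the scope of a prefix. -/
def Proc.Guarded {K : Type u} {ar : K → ℕ} : Proc ar → Prop
  | .sum _ => True
  | .par P Q => P.Guarded ∧ Q.Guarded
  | .nu P => P.Guarded
  | .snu _ P => P.Guarded
  | .call _ _ => False

/-- A set of constant definitions `A(x₁, …, xₙ) := P`. In the body of `A`, the formal parameters
`x₁, …, xₙ` are the channel indices `0, …, n - 1`. -/
abbrev Env {K : Type u} (ar : K → ℕ) : Type u := K → Proc ar

/-- The defining term of `A` with the parameters instantiated by `y`. The value on indices that
are not parameters is irrelevant, as these do not occur in the bodies of well-formed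
definitions. -/
def Env.inst {K : Type u} {ar : K → ℕ} (D : Env ar) (A : K) (y : Fin (ar A) → ℕ) : Proc ar :=
  (D A).ren (fun i => if h : i < ar A then y ⟨i, h⟩ else i) id

/-- `P` becomes `P'` by replacing one occurrence of a constant by its defining term. -/
inductive Unfold {K : Type u} {ar : K → ℕ} (D : Env ar) : Proc ar → Proc ar → Prop
  | call (A : K) (y : Fin (ar A) → ℕ) : Unfold D (.call A y) (D.inst A y)
  | parL {P P' : Proc ar} (Q : Proc ar) : Unfold D P P' → Unfold D (.par P Q) (.par P' Q)
  | parR {Q Q' : Proc ar} (P : Proc ar) : Unfold D Q Q' → Unfold D (.par P Q) (.par P Q')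
  | nu {P P' : Proc ar} : Unfold D P P' → Unfold D (.nu P) (.nu P')
  | snu (r : Rate) {P P' : Proc ar} : Unfold D P P' → Unfold D (.snu r P) (.snu r P')
  | pre (a : Act) {P P' : Proc ar} :
      Unfold D P P' → Unfold D (.sum (.pre a P)) (.sum (.pre a P'))
  | addL {M M' : GSum ar} (N : GSum ar) :
      Unfold D (.sum M) (.sum M') → Unfold D (.sum (.add M N)) (.sum (.add M' N))
  | addR {N N' : GSum ar} (M : GSum ar) :
      Unfold D (.sum N) (.sum N') → Unfold D (.sum (.add M N)) (.sum (.add M N'))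

/-- The standing assumptions on constant definitions: the defining terms belong to the plain
calculus, their free names are among the formal parameters, and recursion is weakly guarded. -/
structure Env.WellFormed {K : Type u} {ar : K → ℕ} (D : Env ar) : Prop where
  plain : ∀ A, (D A).IsPlain
  closed : ∀ A, (D A).ChanLT (ar A)
  guarded : ∀ A, ∃ P', Relation.ReflTransGen (Unfold D) (D A) P' ∧ P'.Guarded

/-- Structural congruence. -/
inductive Cong {K : Type u} {ar : K → ℕ} (D : Env ar) : Proc ar → Proc ar → Prop
  | refl (P : Proc ar) : Cong D P P
  | symm {P Q : Proc ar} : Cong D P Q → Cong D Q P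
  | trans {P Q R : Proc ar} : Cong D P Q → Cong D Q R → Cong D P R
  -- closure under contexts
  | par {P P' Q Q' : Proc ar} : Cong D P P' → Cong D Q Q' → Cong D (.par P Q) (.par P' Q')
  | nu {P P' : Proc ar} : Cong D P P' → Cong D (.nu P) (.nu P')
  | snu (r : Rate) {P P' : Proc ar} : Cong D P P' → Cong D (.snu r P) (.snu r P')
  | pre (a : Act) {P P' : Proc ar} : Cong D P P' → Cong D (.sum (.pre a P)) (.sum (.pre a P'))
  | add {M M' N N' : GSum ar} : Cong D (.sum M) (.sum M') → Cong D (.sum N) (.sum N') →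
      Cong D (.sum (.add M N)) (.sum (.add M' N'))
  -- scope extrusion
  | nu_par (P Q : Proc ar) : Cong D (.par (.nu P) Q) (.nu (.par P Q.up))
  | snu_par (r : Rate) (P Q : Proc ar) : Cong D (.par (.snu r P) Q) (.snu r (.par P Q.sup))
  -- exchange of binders
  | nu_nu (P : Proc ar) : Cong D (.nu (.nu P)) (.nu (.nu (P.ren swap01 id)))
  | nu_snu (r : Rate) (P : Proc ar) : Cong D (.nu (.snu r P)) (.snu r (.nu P))
  | snu_snu (r s : Rate) (P : Proc ar) :
      Cong D (.snu r (.snu s P)) (.snu s (.snu r (P.ren id swap01)))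
  -- binders over the inactive term
  | nu_nil : Cong D (.nu .nil) .nil
  | snu_nil (r : Rate) : Cong D (.snu r .nil) .nil
  -- sums
  | add_assoc (M₁ M₂ M₃ : GSum ar) :
      Cong D (.sum (.add (.add M₁ M₂) M₃)) (.sum (.add M₁ (.add M₂ M₃)))
  | add_comm (M N : GSum ar) : Cong D (.sum (.add M N)) (.sum (.add N M))
  | add_nil (M : GSum ar) : Cong D (.sum (.add M .nil)) (.sum M)
  -- parallel composition
  | par_assoc (P₁ P₂ P₃ : Proc ar) : Cong D (.par (.par P₁ P₂) P₃) (.par P₁ (.par P₂ P₃))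
  | par_comm (P Q : Proc ar) : Cong D (.par P Q) (.par Q P)
  | par_nil (P : Proc ar) : Cong D (.par P .nil) P
  -- constants
  | unfold (A : K) (y : Fin (ar A) → ℕ) : Cong D (.call A y) (D.inst A y)
  -- a Markovian delay is a freshly bound symbolic delay
  | rate (r : Rate) (P : Proc ar) (M : GSum ar) :
      Cong D (.sum (.add (.pre (.rate r) P) M))
        (.snu r (.sum (.add (.pre (.sto 0) P.sup) M.sup)))

/-- Reductions (label `none`) and symbolically quantified transitions (label `some q`). Under a
stochastic binder the outer name `q` is the index `q + 1`, so that the bound name `0` never becomes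
a label. -/
inductive Red {K : Type u} {ar : K → ℕ} (D : Env ar) : Proc ar → Option ℕ → Proc ar → Prop
  | sto (q : ℕ) (P : Proc ar) (M : GSum ar) : Red D (.sum (.add (.pre (.sto q) P) M)) (some q) P
  | tau (P : Proc ar) (M : GSum ar) : Red D (.sum (.add (.pre .tau P) M)) none P
  | comm (x y : ℕ) (P Q : Proc ar) (M N : GSum ar) :
      Red D (.par (.sum (.add (.pre (.inp x) P) M)) (.sum (.add (.pre (.out x y) Q) N))) none
        (.par (P.ren (inst y) id) Q)
  | par {P P' : Proc ar} {l : Option ℕ} (Q : Proc ar) :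
      Red D P l P' → Red D (.par P Q) l (.par P' Q)
  | nu {P P' : Proc ar} {l : Option ℕ} : Red D P l P' → Red D (.nu P) l (.nu P')
  | snu (r : Rate) {P P' : Proc ar} {l : Option ℕ} :
      Red D P (l.map Nat.succ) P' → Red D (.snu r P) l (.snu r P')
  | cong {P Q Q' P' : Proc ar} {l : Option ℕ} :
      Cong D P Q → Red D Q l Q' → Cong D Q' P' → Red D P l P'

/-- Structural congruence as a setoid. -/
def congSetoid {K : Type u} {ar : K → ℕ} (D : Env ar) : Setoid (Proc ar) where
  r := Cong D
  iseqv := ⟨Cong.refl, Cong.symm, Cong.trans⟩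

/-- Congruence classes of terms. -/
abbrev Cls {K : Type u} {ar : K → ℕ} (D : Env ar) : Type u := Quotient (congSetoid D)

/-- The congruence class of a term. -/
def cls {K : Type u} {ar : K → ℕ} (D : Env ar) (P : Proc ar) : Cls D :=
  Quotient.mk (congSetoid D) P

/-- The stochastic binder on congruence classes. -/
def Cls.snu {K : Type u} {ar : K → ℕ} {D : Env ar} (r : Rate) : Cls D → Cls D :=
  Quotient.map (sa := congSetoid D) (sb := congSetoid D) (Proc.snu r) (fun _ _ h => Cong.snu r h)

/-- Rate distributions over `S`: nonempty finite multisets of pairs of a rate and an element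
of `S`. -/
abbrev RDist (S : Type u) : Type u := {m : Multiset (Rate × S) // m ≠ 0}

/-- The rate distribution with the single element `(r, e)`. -/
def RDist.single {S : Type u} (r : Rate) (e : S) : RDist S := ⟨{(r, e)}, by simp⟩

/-- Union of rate distributions, adding multiplicities. -/
def RDist.union {S : Type u} (σ τ : RDist S) : RDist S :=
  ⟨σ.1 + τ.1, fun h => σ.2 (add_eq_zero.mp h).1⟩

/-- `(ν q → r) σ`: the stochastic binder is put in front of every target, rates are unchanged. -/
def RDist.snu {K : Type u} {ar : K → ℕ} {D : Env ar} (r : Rate) (σ : RDist (Cls D)) :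
    RDist (Cls D) :=
  ⟨σ.1.map (fun p => (p.1, Cls.snu r p.2)), fun h => σ.2 (Multiset.map_eq_zero.mp h)⟩

/-- Inference of stochastic transitions by the three rules, where the negative premise of the
second rule is read as membership in a given set `N` of terms. -/
inductive StoStep {K : Type u} {ar : K → ℕ} (D : Env ar) (N : Set (Proc ar)) :
    Proc ar → RDist (Cls D) → Prop
  | sto1 (r : Rate) {P P' : Proc ar} {σ : RDist (Cls D)} :
      StoStep D N P σ → Red D P (some 0) P' →
      StoStep D N (.snu r P) ((σ.snu r).union (.single r (cls D (.snu r P'))))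
  | sto2 (r : Rate) {P P' : Proc ar} :
      P ∈ N → Red D P (some 0) P' →
      StoStep D N (.snu r P) (.single r (cls D (.snu r P')))
  | cong {P Q : Proc ar} {σ : RDist (Cls D)} : Cong D P Q → StoStep D N Q σ → StoStep D N P σ

/-- The terms without transition when the negative premises are read as membership in `N`. -/
def stuck {K : Type u} {ar : K → ℕ} (D : Env ar) (N : Set (Proc ar)) : Set (Proc ar) :=
  {P | ∀ σ, ¬ StoStep D N P σ}

/-- The terms whose negative premise `P ↛` holds. As the rules have a negative premise, "the
relation defined by the rules" is their well-founded model, which for rules that can be stratified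
is the relation obtained stratum by stratum; its set of negative facts is the least fixed point
of applying the antitone operation `stuck D` twice. The facts proved below show that, for
well-formed constant definitions, this set consists of exactly the terms that have no stochastic
transition, and that no other relation solves the rules. -/
def refuted {K : Type u} {ar : K → ℕ} (D : Env ar) : Set (Proc ar) :=
  ⋂₀ {N | stuck D (stuck D N) ⊆ N}

/-- The stochastic transition relation `P ⟶ σ`. -/
def StoTrans {K : Type u} {ar : K → ℕ} (D : Env ar) (P : Proc ar) (σ : RDist (Cls D)) : Prop :=
  StoStep D (refuted D) P σ

section WellDefined

variable {K : Type u} {ar : K → ℕ}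

/-- A term that has a top-level stochastic binder able to perform its delay. -/
def Enabled (D : Env ar) (P : Proc ar) : Prop :=
  ∃ r Q Q', Cong D P (.snu r Q) ∧ Red D Q (some 0) Q'

theorem StoStep.enabled {D : Env ar} {N : Set (Proc ar)} {P : Proc ar} {σ : RDist (Cls D)}
    (h : StoStep D N P σ) : Enabled D P := by
  induction h with
  | sto1 r _ h _ => exact ⟨r, _, _, .refl _, h⟩
  | sto2 r _ h => exact ⟨r, _, _, .refl _, h⟩
  | cong hc _ ih =>
    obtain ⟨r, Q, Q', h1, h2⟩ := ih
    exact ⟨r, Q, Q', hc.trans h1, h2⟩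

theorem StoStep.mono {D : Env ar} {N N' : Set (Proc ar)} (hN : N ⊆ N') {P : Proc ar}
    {σ : RDist (Cls D)} (h : StoStep D N P σ) : StoStep D N' P σ := by
  induction h with
  | sto1 r _ h ih => exact .sto1 r ih h
  | sto2 r hP h => exact .sto2 r (hN hP) h
  | cong hc _ ih => exact .cong hc ih

mutual
/-- An unguarded free occurrence of the prefix `(q)`. -/
def Proc.Occ (q : ℕ) : Proc ar → Prop
  | .sum M => M.Occ q
  | .par P Q => P.Occ q ∨ Q.Occ q
  | .nu P => P.Occ q
  | .snu _ P => P.Occ (q + 1)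
  | .call _ _ => False
def GSum.Occ (q : ℕ) : GSum ar → Prop
  | .nil => False
  | .pre a _ => a = .sto q
  | .add M N => M.Occ q ∨ N.Occ q
end

/-- The number of Markovian delays of a sum. -/
def GSum.nrate : GSum ar → ℕ
  | .pre (.rate _) _ => 1
  | .add M N => M.nrate + N.nrate
  | _ => 0

theorem exists_lift_succ (g : ℕ → ℕ) (p : ℕ → Prop) (q : ℕ) :
    (∃ k, lift g k = q + 1 ∧ p k) ↔ ∃ k, g k = q ∧ p (k + 1) := by
  constructor
  · rintro ⟨_ | k, h, hk⟩
    · simp [lift] at h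
    · exact ⟨k, by simpa [lift] using h, hk⟩
  · rintro ⟨k, h, hk⟩
    exact ⟨k + 1, by simp [lift, h], hk⟩

theorem exists_lift_zero (g : ℕ → ℕ) (p : ℕ → Prop) : (∃ k, lift g k = 0 ∧ p k) ↔ p 0 := by
  constructor
  · rintro ⟨_ | k, h, hk⟩
    · exact hk
    · simp [lift] at h
  · exact fun h => ⟨0, rfl, h⟩

theorem GSum.occ_ren (f g : ℕ → ℕ) (q : ℕ) :
    (M : GSum ar) → ((M.ren f g).Occ q ↔ ∃ k, g k = q ∧ M.Occ k)
  | .nil => by simp [GSum.ren, GSum.Occ]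
  | .pre a P => by cases a <;> simp [GSum.ren, GSum.Occ, Act.ren]
  | .add M N => by
    simp only [GSum.ren, GSum.Occ, GSum.occ_ren f g q M, GSum.occ_ren f g q N, and_or_left,
      exists_or]

theorem Proc.occ_ren (f g : ℕ → ℕ) (q : ℕ) :
    (P : Proc ar) → ((P.ren f g).Occ q ↔ ∃ k, g k = q ∧ P.Occ k)
  | .sum M => by simpa [Proc.ren, Proc.Occ] using GSum.occ_ren f g q M
  | .par P Q => by
    simp only [Proc.ren, Proc.Occ, Proc.occ_ren f g q P, Proc.occ_ren f g q Q, and_or_left,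
      exists_or]
  | .nu P => by simpa [Proc.ren, Proc.Occ] using Proc.occ_ren (lift f) g q P
  | .snu r P => by
    simp only [Proc.ren, Proc.Occ, Proc.occ_ren f (lift g) (q + 1) P, exists_lift_succ]
  | .call _ _ => by simp [Proc.ren, Proc.Occ]

theorem GSum.nrate_ren (f g : ℕ → ℕ) : (M : GSum ar) → (M.ren f g).nrate = M.nrate
  | .nil => by simp [GSum.ren, GSum.nrate]
  | .pre a P => by cases a <;> simp [GSum.ren, GSum.nrate, Act.ren]
  | .add M N => by
    simp only [GSum.ren, GSum.nrate, GSum.nrate_ren f g M, GSum.nrate_ren f g N]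

theorem GSum.IsPlain.not_occ (q : ℕ) : (M : GSum ar) → M.IsPlain → ¬ M.Occ q
  | .nil, _ => by simp [GSum.Occ]
  | .pre a P, h => by cases a <;> simp_all [GSum.IsPlain, GSum.Occ, Act.IsPlain]
  | .add M N, h => by
    simp only [GSum.IsPlain] at h
    simp [GSum.Occ, GSum.IsPlain.not_occ q M h.1, GSum.IsPlain.not_occ q N h.2]

theorem Proc.IsPlain.not_occ (q : ℕ) : (P : Proc ar) → P.IsPlain → ¬ P.Occ q
  | .sum M, h => by simpa [Proc.Occ] using GSum.IsPlain.not_occ q M (by simpa [Proc.IsPlain] using h)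
  | .par P Q, h => by
    simp only [Proc.IsPlain] at h
    simp [Proc.Occ, Proc.IsPlain.not_occ q P h.1, Proc.IsPlain.not_occ q Q h.2]
  | .nu P, h => by
    simpa [Proc.Occ] using Proc.IsPlain.not_occ q P (by simpa [Proc.IsPlain] using h)
  | .snu r P, h => by simp [Proc.IsPlain] at h
  | .call _ _, _ => by simp [Proc.Occ]

theorem Cong.occ {D : Env ar} (hD : D.WellFormed) {P Q : Proc ar} (h : Cong D P Q) :
    ∀ q, P.Occ q ↔ Q.Occ q := by
  induction h with
  | refl => simp
  | symm _ ih => exact fun q => (ih q).symm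
  | trans _ _ ih1 ih2 => exact fun q => (ih1 q).trans (ih2 q)
  | par _ _ ih1 ih2 => intro q; simp [Proc.Occ, ih1, ih2]
  | nu _ ih => intro q; simp [Proc.Occ, ih]
  | snu _ _ ih => intro q; simp [Proc.Occ, ih]
  | pre => intro q; simp [Proc.Occ, GSum.Occ]
  | add _ _ ih1 ih2 => intro q; simpa [Proc.Occ, GSum.Occ] using or_congr (ih1 q) (ih2 q)
  | nu_par => intro q; simp [Proc.Occ, Proc.up, Proc.occ_ren]
  | snu_par => intro q; simp [Proc.Occ, Proc.sup, Proc.occ_ren]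
  | nu_nu => intro q; simp [Proc.Occ, Proc.occ_ren]
  | nu_snu => intro q; simp [Proc.Occ]
  | snu_snu =>
    intro q
    simp only [Proc.Occ, Proc.occ_ren]
    constructor
    · exact fun h => ⟨q + 1 + 1, rfl, h⟩
    · rintro ⟨_ | _ | k, h, hk⟩
      · simp [swap01] at h
      · simp [swap01] at h
      · simp only [swap01] at h
        exact h ▸ hk
  | nu_nil => intro q; simp [Proc.Occ, Proc.nil]
  | snu_nil => intro q; simp [Proc.Occ, GSum.Occ, Proc.nil]
  | add_assoc => intro q; simp [Proc.Occ, GSum.Occ, or_assoc]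
  | add_comm => intro q; simp [Proc.Occ, GSum.Occ, or_comm]
  | add_nil => intro q; simp [Proc.Occ, GSum.Occ]
  | par_assoc => intro q; simp [Proc.Occ, or_assoc]
  | par_comm => intro q; simp [Proc.Occ, or_comm]
  | par_nil => intro q; simp [Proc.Occ, Proc.nil, GSum.Occ]
  | unfold A y =>
    intro q
    simp [Proc.Occ, Env.inst, Proc.occ_ren, Proc.IsPlain.not_occ _ _ (hD.plain A)]
  | rate => intro q; simp [Proc.Occ, GSum.Occ, GSum.sup, GSum.occ_ren]

theorem Red.occ {D : Env ar} (hD : D.WellFormed) {P P' : Proc ar} {l : Option ℕ}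
    (h : Red D P l P') : ∀ q, l = some q → P.Occ q := by
  induction h with
  | sto => intro q h; simp_all [Proc.Occ, GSum.Occ]
  | tau => simp
  | comm => simp
  | par _ _ ih => intro q h; simp [Proc.Occ, ih q h]
  | nu _ ih => intro q h; simp [Proc.Occ, ih q h]
  | snu _ _ ih => intro q h; simpa [Proc.Occ] using ih (q + 1) (by simp [h])
  | cong hc _ _ ih => intro q h; exact (hc.occ hD q).2 (ih q h)

open Classical in
/-- The truth value of a proposition as a number. -/
noncomputable def ind (p : Prop) : ℕ := if p then 1 else 0

/-- The number of unguarded delays of a term that are Markovian or bound by a stochastic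
binder. -/
inductive Rank (D : Env ar) : Proc ar → ℕ → Prop
  | sum (M : GSum ar) : Rank D (.sum M) M.nrate
  | par {P Q : Proc ar} {m n : ℕ} : Rank D P m → Rank D Q n → Rank D (.par P Q) (m + n)
  | nu {P : Proc ar} {n : ℕ} : Rank D P n → Rank D (.nu P) n
  | snu (r : Rate) {P : Proc ar} {n : ℕ} :
      Rank D P n → Rank D (.snu r P) (n + ind (P.Occ 0))
  | call (A : K) (y : Fin (ar A) → ℕ) {n : ℕ} : Rank D (D A) n → Rank D (.call A y) n

theorem Rank.unique {D : Env ar} {P : Proc ar} {n : ℕ} (h : Rank D P n) :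
    ∀ m, Rank D P m → m = n := by
  induction h with
  | sum => rintro _ ⟨⟩; rfl
  | par _ _ ih1 ih2 => rintro _ (_ | ⟨h1, h2⟩); rw [ih1 _ h1, ih2 _ h2]
  | nu _ ih => intro m h; cases h with | nu h => exact ih _ h
  | snu _ _ ih => intro m h; cases h with | snu _ h => rw [ih _ h]
  | call _ _ _ ih => intro m h; cases h with | call _ _ h => exact ih _ h

theorem Rank.ren {D : Env ar} {P : Proc ar} {n : ℕ} (h : Rank D P n) :
    ∀ f g, Rank D (P.ren f g) n := by
  induction h with
  | sum M => intro f g; simpa [Proc.ren, GSum.nrate_ren] using Rank.sum (D := D) (M.ren f g)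
  | par _ _ ih1 ih2 => intro f g; simpa [Proc.ren] using (ih1 f g).par (ih2 f g)
  | nu _ ih => intro f g; simpa [Proc.ren] using (ih (lift f) g).nu
  | snu r _ ih =>
    intro f g
    have h := (ih f (lift g)).snu r
    rw [Proc.occ_ren, exists_lift_zero] at h
    simpa [Proc.ren] using h
  | call A y h _ => intro f g; simpa [Proc.ren] using Rank.call A _ h

theorem Rank.of_ren {D : Env ar} {P₀ : Proc ar} {n : ℕ} (h : Rank D P₀ n) :
    ∀ (P : Proc ar) (f g : ℕ → ℕ), P.ren f g = P₀ → ∃ m, Rank D P m := by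
  induction h with
  | sum => rintro (_ | _ | _ | _ | _) f g h <;> simp [Proc.ren] at h; exact ⟨_, .sum _⟩
  | par _ _ ih1 ih2 =>
    rintro (_ | ⟨P, Q⟩ | _ | _ | _) f g h <;> simp [Proc.ren] at h
    obtain ⟨_, h1⟩ := ih1 _ _ _ h.1
    obtain ⟨_, h2⟩ := ih2 _ _ _ h.2
    exact ⟨_, h1.par h2⟩
  | nu _ ih =>
    rintro (_ | _ | _ | _ | _) f g h <;> simp [Proc.ren] at h
    obtain ⟨_, h1⟩ := ih _ _ _ h
    exact ⟨_, h1.nu⟩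
  | snu r _ ih =>
    rintro (_ | _ | _ | _ | _) f g h <;> simp [Proc.ren] at h
    obtain ⟨_, h1⟩ := ih _ _ _ h.2
    exact ⟨_, h1.snu _⟩
  | call A y h' _ =>
    rintro (_ | _ | _ | _ | _) f g h <;> simp [Proc.ren] at h
    obtain ⟨rfl, h⟩ := h
    exact ⟨_, .call _ _ h'⟩

theorem Rank.exists_of_guarded (D : Env ar) : (P : Proc ar) → P.Guarded → ∃ n, Rank D P n
  | .sum _, _ => ⟨_, .sum _⟩
  | .par P Q, h => by
    simp only [Proc.Guarded] at h
    obtain ⟨_, h1⟩ := Rank.exists_of_guarded D P h.1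
    obtain ⟨_, h2⟩ := Rank.exists_of_guarded D Q h.2
    exact ⟨_, h1.par h2⟩
  | .nu P, h => by
    simp only [Proc.Guarded] at h
    obtain ⟨_, h1⟩ := Rank.exists_of_guarded D P h
    exact ⟨_, h1.nu⟩
  | .snu r P, h => by
    simp only [Proc.Guarded] at h
    obtain ⟨_, h1⟩ := Rank.exists_of_guarded D P h
    exact ⟨_, h1.snu r⟩
  | .call _ _, h => by simp [Proc.Guarded] at h

theorem Unfold.rank {D : Env ar} {P P' : Proc ar} (h : Unfold D P P') :
    (∃ n, Rank D P' n) → ∃ n, Rank D P n := by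
  induction h with
  | call A y =>
    rintro ⟨n, h⟩
    obtain ⟨m, h⟩ := h.of_ren _ _ _ rfl
    exact ⟨m, .call A y h⟩
  | parL Q _ ih =>
    rintro ⟨_, _ | ⟨h1, h2⟩⟩
    obtain ⟨_, h⟩ := ih ⟨_, h1⟩
    exact ⟨_, h.par h2⟩
  | parR Q _ ih =>
    rintro ⟨_, _ | ⟨h1, h2⟩⟩
    obtain ⟨_, h⟩ := ih ⟨_, h2⟩
    exact ⟨_, h1.par h⟩
  | nu _ ih =>
    rintro ⟨_, h⟩
    cases h with
    | nu h => obtain ⟨_, h⟩ := ih ⟨_, h⟩; exact ⟨_, h.nu⟩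
  | snu r _ ih =>
    rintro ⟨_, h⟩
    cases h with
    | snu _ h => obtain ⟨_, h⟩ := ih ⟨_, h⟩; exact ⟨_, h.snu r⟩
  | pre | addL | addR => exact fun _ => ⟨_, .sum _⟩

theorem Rank.exists_body {D : Env ar} (hD : D.WellFormed) (A : K) : ∃ n, Rank D (D A) n := by
  obtain ⟨P', h, hg⟩ := hD.guarded A
  generalize D A = P at h
  induction h using Relation.ReflTransGen.head_induction_on with
  | refl => exact Rank.exists_of_guarded D _ hg
  | head h _ ih => exact h.rank ih

theorem Rank.exists {D : Env ar} (hD : D.WellFormed) : (P : Proc ar) → ∃ n, Rank D P n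
  | .sum _ => ⟨_, .sum _⟩
  | .par P Q => by
    obtain ⟨_, h1⟩ := Rank.exists hD P
    obtain ⟨_, h2⟩ := Rank.exists hD Q
    exact ⟨_, h1.par h2⟩
  | .nu P => by
    obtain ⟨_, h1⟩ := Rank.exists hD P
    exact ⟨_, h1.nu⟩
  | .snu r P => by
    obtain ⟨_, h1⟩ := Rank.exists hD P
    exact ⟨_, h1.snu r⟩
  | .call A y => by
    obtain ⟨_, h1⟩ := Rank.exists_body hD A
    exact ⟨_, .call A y h1⟩

theorem Cong.rank {D : Env ar} (hD : D.WellFormed) {P Q : Proc ar} (h : Cong D P Q) :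
    ∀ m n, Rank D P m → Rank D Q n → m = n := by
  classical
  have ex := Rank.exists hD
  have key : ∀ {P Q : Proc ar}, (∃ n, Rank D P n ∧ Rank D Q n) →
      ∀ m n, Rank D P m → Rank D Q n → m = n := by
    rintro P Q ⟨k, h1, h2⟩ m n hm hn
    rw [h1.unique m hm, h2.unique n hn]
  induction h with
  | refl P => exact fun m n h1 h2 => h2.unique _ h1
  | symm _ ih => exact fun m n h1 h2 => (ih _ _ h2 h1).symm
  | @trans P Q R _ _ ih1 ih2 =>
    intro m n h1 h2
    obtain ⟨k, hk⟩ := ex Q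
    exact (ih1 _ _ h1 hk).trans (ih2 _ _ hk h2)
  | @par P P' Q Q' _ _ ih1 ih2 =>
    rintro _ _ (_ | ⟨h1, h2⟩) (_ | ⟨h3, h4⟩)
    rw [ih1 _ _ h1 h3, ih2 _ _ h2 h4]
  | nu _ ih =>
    intro m n h1 h2
    cases h1 with
    | nu h1 => cases h2 with | nu h2 => exact ih _ _ h1 h2
  | snu r hc ih =>
    intro m n h1 h2
    cases h1 with
    | snu _ h1 => cases h2 with | snu _ h2 => rw [ih _ _ h1 h2]; simp [hc.occ hD 0]
  | pre a _ ih =>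
    rintro _ _ ⟨⟩ ⟨⟩
    cases a <;> rfl
  | @add M M' N N' _ _ ih1 ih2 =>
    rintro _ _ ⟨⟩ ⟨⟩
    simp [GSum.nrate, ih1 _ _ (.sum _) (.sum _), ih2 _ _ (.sum _) (.sum _)]
  | nu_par P Q =>
    obtain ⟨m, h1⟩ := ex P
    obtain ⟨n, h2⟩ := ex Q
    exact key ⟨_, h1.nu.par h2, (h1.par (h2.ren _ _)).nu⟩
  | snu_par r P Q =>
    obtain ⟨m, h1⟩ := ex P
    obtain ⟨n, h2⟩ := ex Q
    refine key ⟨_, (h1.snu r).par h2, ?_⟩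
    have := (h1.par (h2.ren id Nat.succ)).snu r
    have e : (Proc.par P (Q.ren id Nat.succ)).Occ 0 ↔ P.Occ 0 := by
      simp [Proc.Occ, Proc.occ_ren]
    rw [e, Nat.add_right_comm] at this
    exact this
  | nu_nu P =>
    obtain ⟨m, h1⟩ := ex P
    exact key ⟨_, h1.nu.nu, (h1.ren _ _).nu.nu⟩
  | nu_snu r P =>
    obtain ⟨m, h1⟩ := ex P
    exact key ⟨_, (h1.snu r).nu, h1.nu.snu r⟩
  | snu_snu r s P =>
    obtain ⟨m, h1⟩ := ex P
    refine key ⟨_, (h1.snu s).snu r, ?_⟩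
    have := ((h1.ren id swap01).snu r).snu s
    have e0 : (P.ren id swap01).Occ 0 ↔ P.Occ 1 := by
      rw [Proc.occ_ren]
      constructor
      · rintro ⟨_ | _ | k, h, hk⟩
        · simp [swap01] at h
        · exact hk
        · simp [swap01] at h
      · exact fun h => ⟨1, rfl, h⟩
    have e1 : (P.ren id swap01).Occ 1 ↔ P.Occ 0 := by
      rw [Proc.occ_ren]
      constructor
      · rintro ⟨_ | _ | k, h, hk⟩
        · exact hk
        · simp [swap01] at h
        · simp [swap01] at h
      · exact fun h => ⟨0, rfl, h⟩
    rw [show (Proc.snu r (P.ren id swap01)).Occ 0 ↔ (P.ren id swap01).Occ 1 from Iff.rfl,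
      e0, e1] at this
    convert this using 1
    rw [show (Proc.snu s P).Occ 0 ↔ P.Occ 1 from Iff.rfl]
    omega
  | nu_nil => exact key ⟨_, (Rank.sum _).nu, .sum _⟩
  | snu_nil r => 
    refine key ⟨_, (Rank.sum .nil).snu r, ?_⟩
    have : ind ((Proc.sum (.nil : GSum ar)).Occ 0) = 0 := by simp [ind, Proc.Occ, GSum.Occ]
    rw [this]
    exact .sum _
  | add_assoc => rintro _ _ ⟨⟩ ⟨⟩; simp [GSum.nrate, Nat.add_assoc]
  | add_comm => rintro _ _ ⟨⟩ ⟨⟩; simp [GSum.nrate, Nat.add_comm]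
  | add_nil => rintro _ _ ⟨⟩ ⟨⟩; simp [GSum.nrate]
  | par_assoc P Q R =>
    obtain ⟨_, h1⟩ := ex P
    obtain ⟨_, h2⟩ := ex Q
    obtain ⟨_, h3⟩ := ex R
    exact key ⟨_, (h1.par h2).par h3, by simpa [Nat.add_assoc] using h1.par (h2.par h3)⟩
  | par_comm P Q =>
    obtain ⟨_, h1⟩ := ex P
    obtain ⟨_, h2⟩ := ex Q
    exact key ⟨_, h1.par h2, by simpa [Nat.add_comm] using h2.par h1⟩
  | par_nil P =>
    obtain ⟨_, h1⟩ := ex P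
    exact key ⟨_, h1.par (.sum _), by simpa [GSum.nrate] using h1⟩
  | unfold A y =>
    obtain ⟨_, h1⟩ := Rank.exists_body hD A
    exact key ⟨_, .call A y h1, h1.ren _ _⟩
  | rate r P M =>
    refine key ⟨_, .sum _, ?_⟩
    have := (Rank.sum (D := D) (.add (.pre (.sto 0) P.sup) M.sup)).snu r
    convert this using 1
    simp [ind, Proc.Occ, GSum.Occ, GSum.nrate, GSum.sup, GSum.nrate_ren]
    omega

/-- Enabled terms have a transition already when only terms that are not enabled are admitted in
negative premises. -/
theorem Enabled.stoStep {D : Env ar} (hD : D.WellFormed) {P : Proc ar} (h : Enabled D P) :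
    ∃ σ, StoStep D {Q | ¬ Enabled D Q} P σ := by
  obtain ⟨n, hn⟩ := Rank.exists hD P
  induction n using Nat.strong_induction_on generalizing P with
  | _ n ih =>
    obtain ⟨r, Q, Q', hc, hr⟩ := h
    by_cases hQ : Enabled D Q
    · obtain ⟨m, hm⟩ := Rank.exists hD Q
      have := hc.rank hD _ _ hn (hm.snu r)
      rw [ind, if_pos (hr.occ hD 0 rfl)] at this
      obtain ⟨σ, hσ⟩ := ih m (by omega) hQ hm
      exact ⟨_, .cong hc (.sto1 r hσ hr)⟩
    · exact ⟨_, .cong hc (.sto2 r hQ hr)⟩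

theorem refuted_eq {D : Env ar} (hD : D.WellFormed) : refuted D = {P | ¬ Enabled D P} := by
  have hs : stuck D {P | ¬ Enabled D P} = {P | ¬ Enabled D P} := by
    ext P
    constructor
    · intro h he
      obtain ⟨σ, hσ⟩ := he.stoStep hD
      exact h σ hσ
    · exact fun h σ hσ => h hσ.enabled
  apply Set.Subset.antisymm
  · exact Set.sInter_subset_of_mem (by simp only [Set.mem_ofPred_eq, hs, subset_refl])
  · intro P hP N hN
    exact hN fun σ hσ => hP hσ.enabled

/-- The stochastic transition relation is a relation `R` that is inductively defined by the rules
with their negative premise referring to `R` itself, and the only one. -/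
theorem eq_stoTrans_iff {D : Env ar} (hD : D.WellFormed)
    (R : Proc ar → RDist (Cls D) → Prop) :
    R = StoTrans D ↔ R = StoStep D {P | ∀ σ, ¬ R P σ} := by
  have hT : StoTrans D = StoStep D {P | ¬ Enabled D P} := by
    funext P σ
    rw [StoTrans, refuted_eq hD]
  have main : ∀ S : Proc ar → RDist (Cls D) → Prop, (∀ P, (∃ σ, S P σ) ↔ Enabled D P) →
      {P | ∀ σ, ¬ S P σ} = {P | ¬ Enabled D P} := by
    intro S h
    ext P
    simp [← h P]
  constructor
  · rintro rfl
    rw [main, hT]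
    intro P
    rw [hT]
    exact ⟨fun ⟨σ, h⟩ => h.enabled, fun h => h.stoStep hD⟩
  · intro hR
    rw [hT, ← main R, ← hR]
    intro P
    constructor
    · rintro ⟨σ, h⟩
      rw [hR] at h
      exact h.enabled
    · rintro ⟨r, Q, Q', hc, hr⟩
      by_cases hQ : ∃ σ, R Q σ
      · obtain ⟨σ, h⟩ := hQ
        rw [hR] at h ⊢
        exact ⟨_, .cong hc (.sto1 r h hr)⟩
      · rw [hR]
        exact ⟨_, .cong hc (.sto2 r (by simpa using hQ) hr)⟩

end WellDefined

end MarkovPi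

-- The rules for a stochastic binder select one reduct on the bound name. A binder with two
-- unguarded delays on its name, as in `(ν q → r)((q).A | (q).B)`, can therefore yield different
-- distributions. A plain term has no binder, but its derivations pass through congruent terms that
-- do. The proof shows that an unguarded binder in such a term binds at most one unguarded delay,
-- and then computes the distribution independently of the derivation.
--
-- To each term belongs the finite multiset of its unguarded delays. A delay is labelled by a rate,
-- if it is Markovian or bound, or else by its free name, and is paired with the class of the term
-- that remains when it elapses. Weak guardedness, through `Rank`, ensures that this multiset
-- exists. By `Cong.delays_eq` it is invariant under structural congruence. The law for Markovian
-- delays respects it because a binder of an unused name can be dropped (`Cong.snu_sup`).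
--
-- Linearity, at most one unguarded delay per unguarded binder, holds for plain terms and is also
-- invariant (`Cong.linear_iff`). By induction on derivations, the distribution of a linear term is
-- the multiset of its rated delays (`StoStep.eq_filterMap_rated`). In the first rule the body
-- supplies all rated delays but one, and the reduct supplies that one. In the second rule the body
-- is not enabled, so it has no rated delay: a rated delay could be brought to a top-level binder
-- and fired (`Enabled.of_mem_delays`).

namespace MarkovPi

universe u

variable {K : Type u} {ar : K → ℕ} {D : Env ar}

/-! ### Renaming -/

theorem lift_comp (f f' : ℕ → ℕ) : lift (f' ∘ f) = lift f' ∘ lift f := by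
  funext n; cases n <;> rfl

theorem lift_lift_comp_swap01 (f : ℕ → ℕ) :
    lift (lift f) ∘ swap01 = swap01 ∘ lift (lift f) := by
  funext n; rcases n with _ | _ | n <;> rfl

theorem Act.ren_ren (f g f' g' : ℕ → ℕ) (a : Act) :
    (a.ren f g).ren f' g' = a.ren (f' ∘ f) (g' ∘ g) := by
  cases a <;> rfl

theorem Act.under_ren (f g f' : ℕ → ℕ) (a : Act) :
    (a.ren f g).under f' ∘ a.under f = a.under (f' ∘ f) := by
  cases a <;> simp [Act.under, Act.ren, lift_comp]

mutual
theorem Proc.ren_ren (f g f' g' : ℕ → ℕ) :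
    (P : Proc ar) → (P.ren f g).ren f' g' = P.ren (f' ∘ f) (g' ∘ g)
  | .sum M => by simp only [Proc.ren, GSum.ren_ren f g f' g' M]
  | .par P Q => by simp only [Proc.ren, Proc.ren_ren f g f' g' P, Proc.ren_ren f g f' g' Q]
  | .nu P => by simp only [Proc.ren, Proc.ren_ren _ _ _ _ P, lift_comp]
  | .snu r P => by simp only [Proc.ren, Proc.ren_ren _ _ _ _ P, lift_comp]
  | .call A y => by simp only [Proc.ren, Function.comp_apply]
theorem GSum.ren_ren (f g f' g' : ℕ → ℕ) :
    (M : GSum ar) → (M.ren f g).ren f' g' = M.ren (f' ∘ f) (g' ∘ g)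
  | .nil => rfl
  | .pre a P => by
    simp only [GSum.ren, Act.ren_ren, Proc.ren_ren _ _ _ _ P, Act.under_ren]
  | .add M N => by simp only [GSum.ren, GSum.ren_ren f g f' g' M, GSum.ren_ren f g f' g' N]
end

theorem Act.under_eq_of_lt {n : ℕ} {f f' : ℕ → ℕ} (h : ∀ i < n, f i = f' i) (a : Act) :
    ∀ i < a.bound n, a.under f i = a.under f' i := by
  cases a
  case inp =>
    rintro (_ | i) hi
    · rfl
    · simp only [Act.under, lift, h i (by simpa [Act.bound] using hi)]
  all_goals exact h

mutual
/-- A renaming of a plain term is determined by its values on the free channel names. -/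
theorem Proc.ren_eq_of_isPlain (g g' : ℕ → ℕ) : (P : Proc ar) → P.IsPlain →
    ∀ (n : ℕ) (f f' : ℕ → ℕ), P.ChanLT n → (∀ i < n, f i = f' i) → P.ren f g = P.ren f' g'
  | .sum M => by
    intro hp n f f' hc h
    simp only [Proc.ren, GSum.ren_eq_of_isPlain g g' M hp n f f' hc h]
  | .par P Q => by
    intro hp n f f' hc h
    simp only [Proc.ren, Proc.ren_eq_of_isPlain g g' P hp.1 n f f' hc.1 h,
      Proc.ren_eq_of_isPlain g g' Q hp.2 n f f' hc.2 h]
  | .nu P => by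
    intro hp n f f' hc h
    rw [Proc.ren, Proc.ren, Proc.ren_eq_of_isPlain g g' P hp (n + 1) _ (lift f') hc]
    rintro (_ | i) hi
    · rfl
    · simp only [lift, h i (by omega)]
  | .snu r P => fun hp => hp.elim
  | .call A y => by
    intro hp n f f' hc h
    simp only [Proc.ren, fun i => h (y i) (hc i)]
theorem GSum.ren_eq_of_isPlain (g g' : ℕ → ℕ) : (M : GSum ar) → M.IsPlain →
    ∀ (n : ℕ) (f f' : ℕ → ℕ), M.ChanLT n → (∀ i < n, f i = f' i) → M.ren f g = M.ren f' g'
  | .nil => fun _ _ _ _ _ _ => rfl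
  | .pre a P => by
    intro hp n f f' hc h
    have ha : a.ren f g = a.ren f' g' := by
      have h1 := hp.1
      have h2 := hc.1
      cases a <;> simp_all [Act.ren, Act.IsPlain, Act.ChanLT]
    rw [GSum.ren, GSum.ren, ha, Proc.ren_eq_of_isPlain g g' P hp.2 _ _ (a.under f') hc.2
      (a.under_eq_of_lt h)]
  | .add M N => by
    intro hp n f f' hc h
    simp only [GSum.ren, GSum.ren_eq_of_isPlain g g' M hp.1 n f f' hc.1 h,
      GSum.ren_eq_of_isPlain g g' N hp.2 n f f' hc.2 h]
end

/-- Both sides rename the body of `A` by maps that agree on the parameters. They may differ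
elsewhere, but the body is closed, and being plain it does not see `g`. -/
theorem Env.inst_ren (hD : D.WellFormed) (A : K) (y : Fin (ar A) → ℕ) (f g : ℕ → ℕ) :
    (D.inst A y).ren f g = D.inst A (fun i => f (y i)) := by
  rw [Env.inst, Proc.ren_ren, Env.inst]
  refine Proc.ren_eq_of_isPlain _ _ _ (hD.plain A) _ _ _ (hD.closed A) fun i hi => ?_
  simp [hi]

theorem Proc.up_ren (f g : ℕ → ℕ) (P : Proc ar) : P.up.ren (lift f) g = (P.ren f g).up := by
  simp only [Proc.up, Proc.ren_ren]; rfl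

theorem Proc.sup_ren (f g : ℕ → ℕ) (P : Proc ar) : P.sup.ren f (lift g) = (P.ren f g).sup := by
  simp only [Proc.sup, Proc.ren_ren]; rfl

theorem GSum.sup_ren (f g : ℕ → ℕ) (M : GSum ar) : M.sup.ren f (lift g) = (M.ren f g).sup := by
  simp only [GSum.sup, GSum.ren_ren]; rfl

/-- This makes renaming act on congruence classes. Only the unfolding of constants needs well-formed
definitions. -/
theorem Cong.ren (hD : D.WellFormed) {P Q : Proc ar} (h : Cong D P Q) :
    ∀ f g, Cong D (P.ren f g) (Q.ren f g) := by
  induction h with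
  | refl => exact fun f g => .refl _
  | symm _ ih => exact fun f g => (ih f g).symm
  | trans _ _ ih1 ih2 => exact fun f g => (ih1 f g).trans (ih2 f g)
  | par _ _ ih1 ih2 => exact fun f g => (ih1 f g).par (ih2 f g)
  | nu _ ih => exact fun f g => (ih _ g).nu
  | snu r _ ih => exact fun f g => (ih f _).snu r
  | pre a _ ih => exact fun f g => (ih _ g).pre _
  | add _ _ ih1 ih2 => exact fun f g => (ih1 f g).add (ih2 f g)
  | nu_par P Q =>
    intro f g
    simp only [Proc.ren, Proc.up_ren]
    exact .nu_par _ _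
  | snu_par r P Q =>
    intro f g
    simp only [Proc.ren, Proc.sup_ren]
    exact .snu_par _ _ _
  | nu_nu P =>
    intro f g
    have h := Cong.nu_nu (D := D) (P.ren (lift (lift f)) g)
    simp only [Proc.ren, Proc.ren_ren, lift_lift_comp_swap01] at h ⊢
    exact h
  | nu_snu r P => exact fun f g => .nu_snu _ _
  | snu_snu r s P =>
    intro f g
    have h := Cong.snu_snu (D := D) r s (P.ren f (lift (lift g)))
    simp only [Proc.ren, Proc.ren_ren, lift_lift_comp_swap01] at h ⊢
    exact h
  | nu_nil => exact fun f g => .nu_nil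
  | snu_nil r => exact fun f g => .snu_nil r
  | add_assoc => exact fun f g => .add_assoc _ _ _
  | add_comm => exact fun f g => .add_comm _ _
  | add_nil => exact fun f g => .add_nil _
  | par_assoc => exact fun f g => .par_assoc _ _ _
  | par_comm => exact fun f g => .par_comm _ _
  | par_nil => exact fun f g => .par_nil _
  | unfold A y =>
    intro f g
    rw [Env.inst_ren hD]
    exact .unfold _ _
  | rate r P M =>
    intro f g
    have h := Cong.rate (D := D) r (P.ren f g) (M.ren f g)
    rw [← Proc.sup_ren, ← GSum.sup_ren] at h
    exact h

/-- A stochastic binder of a name that does not occur can be dropped. -/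
theorem Cong.snu_sup (r : Rate) (P : Proc ar) : Cong D (.snu r P.sup) P :=
  -- Write the body as `0 | P.sup`; reversed scope extrusion leaves the binder on `0`, where it
  -- vanishes.
  .trans (.snu r (.trans (.symm (.par_nil _)) (.par_comm _ _)))
    (.trans (.symm (.snu_par r .nil P))
      (.trans (.par (.snu_nil r) (.refl P)) (.trans (.par_comm _ _) (.par_nil P))))

/-! ### Operations on congruence classes -/

theorem cls_eq {P Q : Proc ar} : cls D P = cls D Q ↔ Cong D P Q :=
  Quotient.eq (r := congSetoid D)

theorem Cls.ind_cls {p : Cls D → Prop} (h : ∀ P, p (cls D P)) (C : Cls D) : p C :=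
  Quotient.ind h C

/-- Parallel composition of congruence classes. -/
def Cls.par : Cls D → Cls D → Cls D :=
  Quotient.map₂ (sa := congSetoid D) (sb := congSetoid D) (sc := congSetoid D) Proc.par
    (fun _ _ hP _ _ hQ => Cong.par hP hQ)

/-- Restriction of congruence classes. -/
def Cls.nu : Cls D → Cls D :=
  Quotient.map (sa := congSetoid D) (sb := congSetoid D) Proc.nu (fun _ _ h => Cong.nu h)

/-- Renaming of congruence classes. -/
def Cls.ren (hD : D.WellFormed) (f g : ℕ → ℕ) : Cls D → Cls D :=
  Quotient.map (sa := congSetoid D) (sb := congSetoid D) (Proc.ren f g)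
    (fun _ _ h => Cong.ren hD h f g)

/-! ### The unguarded delays of a term -/

/-- Labels of delays: a rate, for delays that are Markovian or bound, or a free stochastic
name. -/
inductive Delay : Type
  | rate (r : Rate) : Delay
  | sto (q : ℕ) : Delay

/-- Renaming of stochastic names in a label. -/
def Delay.ren (g : ℕ → ℕ) : Delay → Delay
  | .rate r => .rate r
  | .sto q => .sto (g q)

/-- The prefix of a delay. -/
def Delay.toAct : Delay → Act
  | .rate r => .rate r
  | .sto q => .sto q

/-- A label seen from outside a stochastic binder of rate `r`. -/
def Delay.bind (r : Rate) : Delay → Delay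
  | .rate s => .rate s
  | .sto 0 => .rate r
  | .sto (q + 1) => .sto q

@[simp] theorem Delay.bind_ren_succ (r : Rate) (d : Delay) : (d.ren Nat.succ).bind r = d := by
  cases d <;> rfl

theorem Delay.bind_ren_lift (r : Rate) (g : ℕ → ℕ) (d : Delay) :
    (d.ren (lift g)).bind r = (d.bind r).ren g := by
  rcases d with _ | _ | _ <;> rfl

theorem Delay.bind_bind_ren_swap01 (r s : Rate) (d : Delay) :
    ((d.ren swap01).bind r).bind s = (d.bind s).bind r := by
  rcases d with _ | _ | _ | _ <;> rfl

/-- The delays of a sum, each with the class of its continuation. -/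
def GSum.delays (D : Env ar) : GSum ar → Multiset (Delay × Cls D)
  | .pre (.rate r) P => {(.rate r, cls D P)}
  | .pre (.sto q) P => {(.sto q, cls D P)}
  | .add M N => M.delays D + N.delays D
  | _ => 0

/-- `HasDelays D P m`: the unguarded delays of `P`, each with the class of the term that `P`
becomes when that delay elapses, form the multiset `m`. -/
inductive HasDelays (D : Env ar) : Proc ar → Multiset (Delay × Cls D) → Prop
  | sum (M : GSum ar) : HasDelays D (.sum M) (M.delays D)
  | par {P Q : Proc ar} {m n : Multiset (Delay × Cls D)} :
      HasDelays D P m → HasDelays D Q n →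
      HasDelays D (.par P Q) (m.map (Prod.map id fun C => C.par (cls D Q)) +
        n.map (Prod.map id fun C => (cls D P).par C))
  | nu {P : Proc ar} {m : Multiset (Delay × Cls D)} :
      HasDelays D P m → HasDelays D (.nu P) (m.map (Prod.map id Cls.nu))
  | snu (r : Rate) {P : Proc ar} {m : Multiset (Delay × Cls D)} :
      HasDelays D P m → HasDelays D (.snu r P) (m.map (Prod.map (Delay.bind r) (Cls.snu r)))
  -- Unfolding a constant is not structural recursion, hence a relation and not a function.
  | call (A : K) (y : Fin (ar A) → ℕ) {m : Multiset (Delay × Cls D)} :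
      HasDelays D (D.inst A y) m → HasDelays D (.call A y) m

theorem HasDelays.unique {P : Proc ar} {m : Multiset (Delay × Cls D)} (h : HasDelays D P m) :
    ∀ n, HasDelays D P n → n = m := by
  induction h with
  | sum => rintro _ ⟨⟩; rfl
  | par _ _ ih1 ih2 => rintro _ (_ | ⟨h1, h2⟩); rw [ih1 _ h1, ih2 _ h2]
  | nu _ ih => intro m h; cases h with | nu h => rw [ih _ h]
  | snu _ _ ih => intro m h; cases h with | snu _ h => rw [ih _ h]
  | call _ _ _ ih => intro m h; cases h with | call _ _ h => exact ih _ h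

/-- A derivation of `Rank` witnesses that the unfolding of unguarded constants terminates. All
renamings are covered because `Rank` descends to the body of a constant, whereas `HasDelays`
descends to an instance of it. -/
theorem Rank.exists_hasDelays {P : Proc ar} {n : ℕ} (h : Rank D P n) :
    ∀ f g, ∃ m, HasDelays D (P.ren f g) m := by
  induction h with
  | sum M => exact fun f g => ⟨_, .sum _⟩
  | par _ _ ih1 ih2 =>
    intro f g
    obtain ⟨_, h1⟩ := ih1 f g
    obtain ⟨_, h2⟩ := ih2 f g
    exact ⟨_, h1.par h2⟩
  | nu _ ih =>
    intro f g
    obtain ⟨_, h⟩ := ih (lift f) g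
    exact ⟨_, h.nu⟩
  | snu r _ ih =>
    intro f g
    obtain ⟨_, h⟩ := ih f (lift g)
    exact ⟨_, h.snu r⟩
  | call A y _ ih =>
    intro f g
    -- The renaming by which `Env.inst` instantiates the renamed call.
    obtain ⟨_, h⟩ := ih (fun i => if h : i < ar A then f (y ⟨i, h⟩) else i) id
    exact ⟨_, .call A _ h⟩

theorem HasDelays.exists (hD : D.WellFormed) : (P : Proc ar) → ∃ m, HasDelays D P m
  | .sum _ => ⟨_, .sum _⟩
  | .par P Q => by
    obtain ⟨_, h1⟩ := HasDelays.exists hD P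
    obtain ⟨_, h2⟩ := HasDelays.exists hD Q
    exact ⟨_, h1.par h2⟩
  | .nu P => by
    obtain ⟨_, h⟩ := HasDelays.exists hD P
    exact ⟨_, h.nu⟩
  | .snu r P => by
    obtain ⟨_, h⟩ := HasDelays.exists hD P
    exact ⟨_, h.snu r⟩
  | .call A y => by
    obtain ⟨_, hn⟩ := Rank.exists_body hD A
    obtain ⟨_, h⟩ := hn.exists_hasDelays _ _
    exact ⟨_, .call A y h⟩

/-- The multiset of unguarded delays of a term. -/
noncomputable def Proc.delays (hD : D.WellFormed) (P : Proc ar) : Multiset (Delay × Cls D) :=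
  (HasDelays.exists hD P).choose

theorem Proc.hasDelays (hD : D.WellFormed) (P : Proc ar) : HasDelays D P (P.delays hD) :=
  (HasDelays.exists hD P).choose_spec

theorem HasDelays.delays_eq (hD : D.WellFormed) {P : Proc ar} {m : Multiset (Delay × Cls D)}
    (h : HasDelays D P m) : P.delays hD = m :=
  h.unique _ (P.hasDelays hD)

@[simp] theorem delays_sum (hD : D.WellFormed) (M : GSum ar) :
    (Proc.sum M).delays hD = M.delays D :=
  (HasDelays.sum M).delays_eq hD

@[simp] theorem delays_par (hD : D.WellFormed) (P Q : Proc ar) :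
    (Proc.par P Q).delays hD = (P.delays hD).map (Prod.map id fun C => C.par (cls D Q)) +
        (Q.delays hD).map (Prod.map id fun C => (cls D P).par C) :=
  ((P.hasDelays hD).par (Q.hasDelays hD)).delays_eq hD

@[simp] theorem delays_nu (hD : D.WellFormed) (P : Proc ar) :
    (Proc.nu P).delays hD = (P.delays hD).map (Prod.map id Cls.nu) :=
  (P.hasDelays hD).nu.delays_eq hD

@[simp] theorem delays_snu (hD : D.WellFormed) (r : Rate) (P : Proc ar) :
    (Proc.snu r P).delays hD = (P.delays hD).map (Prod.map (Delay.bind r) (Cls.snu r)) :=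
  ((P.hasDelays hD).snu r).delays_eq hD

theorem delays_call (hD : D.WellFormed) (A : K) (y : Fin (ar A) → ℕ) :
    (Proc.call A y).delays hD = (D.inst A y).delays hD :=
  (HasDelays.call A y (Proc.hasDelays hD _)).delays_eq hD

/-- Maps of delays agree if they agree on labels and on classes of terms. -/
theorem map_delays_congr {m : Multiset (Delay × Cls D)} {φ ψ : Delay × Cls D → Delay × Cls D}
    (h : ∀ d P, φ (d, cls D P) = ψ (d, cls D P)) : m.map φ = m.map ψ := by
  refine Multiset.map_congr rfl ?_
  rintro ⟨d, C⟩ -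
  induction C using Cls.ind_cls with
  | h P => exact h d P

theorem map_delays_eq_self {m : Multiset (Delay × Cls D)} {φ : Delay × Cls D → Delay × Cls D}
    (h : ∀ d P, φ (d, cls D P) = (d, cls D P)) : m.map φ = m :=
  (map_delays_congr (ψ := id) h).trans (Multiset.map_id m)

-- Invariance of delays under renaming and congruence

theorem GSum.delays_ren (hD : D.WellFormed) (f g : ℕ → ℕ) : (M : GSum ar) →
    (M.ren f g).delays D = (M.delays D).map (Prod.map (Delay.ren g) (Cls.ren hD f g))
  | .nil => rfl
  | .pre a P => by cases a <;> rfl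
  | .add M N => by
    simp only [GSum.ren, GSum.delays, GSum.delays_ren hD f g M, GSum.delays_ren hD f g N,
      Multiset.map_add]

/-- The induction follows the derivation, not the term, so that it reaches the unfolded body of a
constant. -/
theorem HasDelays.ren (hD : D.WellFormed) {P : Proc ar} {m : Multiset (Delay × Cls D)}
    (h : HasDelays D P m) : ∀ f g, HasDelays D (P.ren f g)
      (m.map (Prod.map (Delay.ren g) (Cls.ren hD f g))) := by
  induction h with
  | sum M =>
    intro f g
    rw [← GSum.delays_ren]
    exact .sum _
  | par _ _ ih1 ih2 =>
    intro f g
    refine (congrArg (HasDelays D _) ?_).mp ((ih1 f g).par (ih2 f g))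
    simp only [Multiset.map_add, Multiset.map_map]
    congr 1 <;> exact map_delays_congr fun d R => rfl
  | nu _ ih =>
    intro f g
    refine (congrArg (HasDelays D _) ?_).mp (ih (lift f) g).nu
    simp only [Multiset.map_map]
    exact map_delays_congr fun d R => rfl
  | snu r _ ih =>
    intro f g
    refine (congrArg (HasDelays D _) ?_).mp ((ih f (lift g)).snu r)
    simp only [Multiset.map_map]
    exact map_delays_congr fun d R => congrArg (Prod.mk · _) (d.bind_ren_lift r g)
  | call A y _ ih =>
    intro f g
    have h := ih f g
    rw [Env.inst_ren hD] at h
    exact .call A _ h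

theorem delays_ren (hD : D.WellFormed) (f g : ℕ → ℕ) (P : Proc ar) :
    (P.ren f g).delays hD = (P.delays hD).map (Prod.map (Delay.ren g) (Cls.ren hD f g)) :=
  ((P.hasDelays hD).ren hD f g).delays_eq hD

theorem Delay.ren_id (d : Delay) : d.ren id = d := by cases d <;> rfl

/-- Congruent terms have the same delays. -/
theorem Cong.delays_eq (hD : D.WellFormed) {P Q : Proc ar} (h : Cong D P Q) :
    P.delays hD = Q.delays hD := by
  induction h with
  | refl => rfl
  | symm _ ih => exact ih.symm
  | trans _ _ ih1 ih2 => exact ih1.trans ih2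
  | par h1 h2 ih1 ih2 =>
    simp only [delays_par, ih1, ih2, cls_eq.2 h1, cls_eq.2 h2]
  | nu _ ih => simp only [delays_nu, ih]
  | snu r _ ih => simp only [delays_snu, ih]
  | pre a h => cases a <;> simp [GSum.delays, cls_eq.2 h]
  | add _ _ ih1 ih2 =>
    simp only [delays_sum] at ih1 ih2
    simp only [delays_sum, GSum.delays, ih1, ih2]
  | nu_par P Q =>
    -- A delay leaves the operators around it in place, so corresponding targets are related by the
    -- very law that relates the sources. The same holds for the other laws on binders and parallel
    -- composition.
    simp only [delays_par, delays_nu, Proc.up, delays_ren, Multiset.map_add, Multiset.map_map]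
    congr 1 <;> refine map_delays_congr fun d R => ?_
    · exact congrArg (Prod.mk d) (cls_eq.2 (.nu_par _ _))
    · exact congrArg₂ Prod.mk d.ren_id.symm (cls_eq.2 (.nu_par _ _))
  | snu_par r P Q =>
    simp only [delays_par, delays_snu, Proc.sup, delays_ren, Multiset.map_add, Multiset.map_map]
    congr 1 <;> refine map_delays_congr fun d R => ?_
    · exact congrArg (Prod.mk _) (cls_eq.2 (.snu_par r _ _))
    · exact congrArg₂ Prod.mk (d.bind_ren_succ r).symm (cls_eq.2 (.snu_par r _ _))
  | nu_nu P =>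
    simp only [delays_nu, delays_ren, Multiset.map_map]
    exact map_delays_congr fun d R => congrArg₂ Prod.mk d.ren_id.symm (cls_eq.2 (.nu_nu _))
  | nu_snu r P =>
    simp only [delays_nu, delays_snu, Multiset.map_map]
    exact map_delays_congr fun d R => congrArg (Prod.mk _) (cls_eq.2 (.nu_snu r _))
  | snu_snu r s P =>
    simp only [delays_snu, delays_ren, Multiset.map_map]
    exact map_delays_congr fun d R =>
      congrArg₂ Prod.mk (d.bind_bind_ren_swap01 r s).symm (cls_eq.2 (.snu_snu r s _))
  | nu_nil => simp [Proc.nil, GSum.delays]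
  | snu_nil => simp [Proc.nil, GSum.delays]
  | add_assoc => simp [GSum.delays, _root_.add_assoc]
  | add_comm => simp [GSum.delays, _root_.add_comm]
  | add_nil => simp [GSum.delays]
  | par_assoc P Q R =>
    simp only [delays_par, Multiset.map_add, Multiset.map_map, _root_.add_assoc]
    congr 1
    · exact map_delays_congr fun d S => congrArg (Prod.mk d) (cls_eq.2 (.par_assoc _ _ _))
    congr 1 <;>
    exact map_delays_congr fun d S => congrArg (Prod.mk d) (cls_eq.2 (.par_assoc _ _ _))
  | par_comm P Q =>
    simp only [delays_par]
    rw [_root_.add_comm]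
    congr 1 <;>
    exact map_delays_congr fun d S => congrArg (Prod.mk d) (cls_eq.2 (.par_comm _ _))
  | par_nil P =>
    simp only [delays_par, Proc.nil, delays_sum, GSum.delays, Multiset.map_zero, add_zero]
    exact map_delays_eq_self fun d S => congrArg (Prod.mk d) (cls_eq.2 (.par_nil _))
  | unfold A y => exact delays_call hD A y
  | rate r P M =>
    simp only [delays_snu, delays_sum, GSum.delays, GSum.sup, GSum.delays_ren hD,
      Multiset.map_add, Multiset.map_singleton, Multiset.map_map]
    congr 1
    -- Binding turns the label `sto 0` into the rate `r`. The fresh name is unused in the targets,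
    -- so the binder around them disappears.
    · exact congrArg (fun C => {(Delay.rate r, C)}) (cls_eq.2 (Cong.snu_sup r P).symm)
    · exact (map_delays_eq_self fun d S =>
        congrArg₂ Prod.mk (d.bind_ren_succ r) (cls_eq.2 (Cong.snu_sup r S))).symm

/-! ### Delays and reductions -/

/-- A symbolic transition fires one unguarded delay and keeps its surroundings. Closure under
congruence is harmless, as delays are invariant and targets are recorded as classes. -/
theorem Red.mem_delays (hD : D.WellFormed) {P P' : Proc ar} {l : Option ℕ}
    (h : Red D P l P') : ∀ q, l = some q → (Delay.sto q, cls D P') ∈ P.delays hD := by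
  induction h with
  | sto => rintro _ ⟨⟩; simp [GSum.delays]
  | tau => simp
  | comm => simp
  | par Q _ ih =>
    intro q h
    rw [delays_par]
    exact Multiset.mem_add.2 (.inl (Multiset.mem_map_of_mem _ (ih q h)))
  | nu _ ih =>
    intro q h
    rw [delays_nu]
    exact Multiset.mem_map_of_mem _ (ih q h)
  | snu r _ ih =>
    intro q h
    rw [delays_snu]
    exact Multiset.mem_map_of_mem (Prod.map (Delay.bind r) (Cls.snu r))
      (ih (q + 1) (by simp [h]))
  | cong h1 _ h2 ih =>
    intro q h
    rw [h1.delays_eq hD, ← cls_eq.2 h2]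
    exact ih q h

/-- Associativity and commutativity bring the prefix to the front. Its continuation is not tracked,
since only the label matters for enabledness. -/
theorem GSum.cong_of_mem_delays {d : Delay} {C : Cls D} : (M : GSum ar) → (d, C) ∈ M.delays D →
    ∃ P N, Cong D (.sum M) (.sum (.add (.pre d.toAct P) N))
  | .nil, h => by simp [GSum.delays] at h
  | .pre a P, h => by
    cases a <;> simp [GSum.delays] at h
    all_goals
      obtain ⟨rfl, rfl⟩ := h
      exact ⟨P, .nil, .symm (.add_nil _)⟩
  | .add M N, h => by
    rw [GSum.delays, Multiset.mem_add] at h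
    rcases h with h | h
    · obtain ⟨P, L, hc⟩ := GSum.cong_of_mem_delays M h
      exact ⟨P, _, .trans (.add hc (.refl _)) (.add_assoc _ _ _)⟩
    · obtain ⟨P, L, hc⟩ := GSum.cong_of_mem_delays N h
      exact ⟨P, _, .trans (.add_comm _ _) (.trans (.add hc (.refl _)) (.add_assoc _ _ _))⟩

/-- A partial converse of `Red.mem_delays`: the label is realised, the target is left open. -/
theorem HasDelays.exists_red {P : Proc ar} {m : Multiset (Delay × Cls D)}
    (h : HasDelays D P m) : ∀ q C, (Delay.sto q, C) ∈ m → ∃ P', Red D P (some q) P' := by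
  induction h with
  | sum M =>
    intro q C h
    obtain ⟨P, N, hc⟩ := M.cong_of_mem_delays h
    exact ⟨P, .cong hc (.sto q P N) (.refl _)⟩
  | par _ _ ih1 ih2 =>
    intro q C h
    simp only [Multiset.mem_add, Multiset.mem_map, Prod.exists, Prod.map_apply, id_eq,
      Prod.mk.injEq] at h
    obtain ⟨_, _, h, rfl, -⟩ | ⟨_, _, h, rfl, -⟩ := h
    · obtain ⟨P', hr⟩ := ih1 _ _ h
      exact ⟨_, hr.par _⟩
    · obtain ⟨P', hr⟩ := ih2 _ _ h
      exact ⟨_, .cong (.par_comm _ _) (hr.par _) (.refl _)⟩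
  | nu _ ih =>
    intro q C h
    simp only [Multiset.mem_map, Prod.exists, Prod.map_apply, id_eq, Prod.mk.injEq] at h
    obtain ⟨_, _, h, rfl, -⟩ := h
    obtain ⟨P', hr⟩ := ih _ _ h
    exact ⟨_, hr.nu⟩
  | snu r _ ih =>
    intro q C h
    simp only [Multiset.mem_map, Prod.exists, Prod.map_apply, Prod.mk.injEq] at h
    obtain ⟨_ | _ | k, _, h, hk, -⟩ := h <;> simp only [Delay.bind, reduceCtorEq,
      Delay.sto.injEq] at hk
    subst hk
    obtain ⟨P', hr⟩ := ih _ _ h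
    exact ⟨_, .snu r hr⟩
  | call A y _ ih =>
    intro q C h
    obtain ⟨P', hr⟩ := ih _ _ h
    exact ⟨_, .cong (.unfold A y) hr (.refl _)⟩

/-- A delay with a rate can be brought into the form of a top-level stochastic binder. -/
theorem HasDelays.exists_cong_snu (hD : D.WellFormed) {P : Proc ar}
    {m : Multiset (Delay × Cls D)} (h : HasDelays D P m) :
    ∀ r C, (Delay.rate r, C) ∈ m →
      ∃ Q E, Cong D P (.snu r Q) ∧ (Delay.sto 0, E) ∈ Q.delays hD := by
  induction h with
  | sum M =>
    intro r C h
    obtain ⟨P, N, hc⟩ := M.cong_of_mem_delays h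
    -- In a sum the delay is Markovian, and its defining law supplies the binder.
    exact ⟨_, _, hc.trans (.rate r P N), by
      rw [delays_sum, GSum.delays, GSum.delays]
      exact Multiset.mem_add.2 (.inl (Multiset.mem_singleton_self _))⟩
  | @par P₁ P₂ _ _ _ _ ih1 ih2 =>
    have key : ∀ {P Q : Proc ar} {r : Rate}, (∃ R E, Cong D P (.snu r R) ∧
        (Delay.sto 0, E) ∈ R.delays hD) →
        ∃ R E, Cong D (.par P Q) (.snu r R) ∧ (Delay.sto 0, E) ∈ R.delays hD := by
      rintro P Q r ⟨R, E, hc, hR⟩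
      refine ⟨_, E.par (cls D Q.sup), .trans (.par hc (.refl _)) (.snu_par r R Q), ?_⟩
      rw [delays_par]
      exact Multiset.mem_add.2
        (.inl (Multiset.mem_map_of_mem (Prod.map id fun C => C.par (cls D Q.sup)) hR))
    intro r C h
    simp only [Multiset.mem_add, Multiset.mem_map, Prod.exists, Prod.map_apply, id_eq,
      Prod.mk.injEq] at h
    obtain ⟨_, _, h, rfl, -⟩ | ⟨_, _, h, rfl, -⟩ := h
    · exact key (ih1 _ _ h)
    · obtain ⟨R, E, hc, hR⟩ := key (Q := P₁) (ih2 _ _ h)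
      exact ⟨R, E, .trans (.par_comm _ _) hc, hR⟩
  | nu _ ih =>
    intro r C h
    simp only [Multiset.mem_map, Prod.exists, Prod.map_apply, id_eq, Prod.mk.injEq] at h
    obtain ⟨_, _, h, rfl, -⟩ := h
    obtain ⟨R, E, hc, hR⟩ := ih _ _ h
    refine ⟨_, E.nu, .trans (.nu hc) (.nu_snu _ R), ?_⟩
    rw [delays_nu]
    exact Multiset.mem_map_of_mem (Prod.map id Cls.nu) hR
  | @snu s P _ hP ih =>
    intro r C h
    simp only [Multiset.mem_map, Prod.exists, Prod.map_apply, Prod.mk.injEq] at h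
    obtain ⟨_ | _ | k, _, h, hk, -⟩ := h <;> simp only [Delay.bind, reduceCtorEq,
      Delay.rate.injEq] at hk
    · subst hk
      obtain ⟨R, E, hc, hR⟩ := ih _ _ h
      -- The binder found inside is exchanged with `s`. Its name becomes index `1` by the swap, and
      -- index `0` again outside the binder `s`.
      refine ⟨_, (E.ren hD id swap01).snu s, .trans (.snu s hc) (.snu_snu s _ R), ?_⟩
      rw [delays_snu, delays_ren]
      exact Multiset.mem_map_of_mem (Prod.map (Delay.bind s) (Cls.snu s))
        (Multiset.mem_map_of_mem (Prod.map (Delay.ren swap01) (Cls.ren hD id swap01)) hR)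
    · subst hk
      -- Here the delay is bound by the outermost binder itself.
      exact ⟨P, _, .refl _, hP.delays_eq hD ▸ h⟩
  | call A y _ ih =>
    intro r C h
    obtain ⟨R, E, hc, hR⟩ := ih _ _ h
    exact ⟨R, E, .trans (.unfold A y) hc, hR⟩

theorem Enabled.of_mem_delays (hD : D.WellFormed) {P : Proc ar} {r : Rate} {C : Cls D}
    (h : (Delay.rate r, C) ∈ P.delays hD) : Enabled D P := by
  obtain ⟨Q, E, hc, hQ⟩ := (P.hasDelays hD).exists_cong_snu hD r C h
  obtain ⟨Q', hr⟩ := (Q.hasDelays hD).exists_red _ _ hQ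
  exact ⟨r, Q, Q', hc, hr⟩

/-! ### Linear terms -/

/-- Whether a label is the innermost stochastic name. -/
def Delay.isZero : Delay → Bool
  | .sto 0 => true
  | _ => false

/-- The number of unguarded delays with the innermost stochastic name. -/
noncomputable def Proc.numZero (hD : D.WellFormed) (P : Proc ar) : ℕ :=
  (P.delays hD).countP fun x => x.1.isZero

theorem countP_map_delays (m : Multiset (Delay × Cls D)) (φ : Delay → Delay)
    (ψ : Cls D → Cls D) : (m.map (Prod.map φ ψ)).countP (fun x => x.1.isZero) =
      m.countP fun x => (φ x.1).isZero := by
  rw [Multiset.countP_map, Multiset.countP_eq_card_filter]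
  rfl

theorem numZero_par (hD : D.WellFormed) (P Q : Proc ar) :
    (Proc.par P Q).numZero hD = P.numZero hD + Q.numZero hD := by
  simp only [Proc.numZero, delays_par, Multiset.countP_add, countP_map_delays, id_eq]

theorem numZero_nu (hD : D.WellFormed) (P : Proc ar) :
    (Proc.nu P).numZero hD = P.numZero hD := by
  simp only [Proc.numZero, delays_nu, countP_map_delays, id_eq]

theorem numZero_ren_lift (hD : D.WellFormed) (f g : ℕ → ℕ) (P : Proc ar) :
    (P.ren f (lift g)).numZero hD = P.numZero hD := by
  have h : ∀ d : Delay, (d.ren (lift g)).isZero = d.isZero := by rintro (_ | _ | _) <;> rfl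
  simp only [Proc.numZero, delays_ren, countP_map_delays, h]

theorem numZero_sup (hD : D.WellFormed) (P : Proc ar) : P.sup.numZero hD = 0 := by
  have h : ∀ d : Delay, (d.ren Nat.succ).isZero = false := by rintro (_ | _) <;> rfl
  simp only [Proc.numZero, Proc.sup, delays_ren, countP_map_delays, h]
  simp

/-- Both sides count the delays of `P` with index `1`; in `numZero_snu_ren_swap01` both count those
with index `0`. Exchanging two binders thus exchanges their counts. -/
theorem numZero_ren_swap01 (hD : D.WellFormed) (s : Rate) (P : Proc ar) :
    (P.ren id swap01).numZero hD = (Proc.snu s P).numZero hD := by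
  have h : ∀ d : Delay, (d.ren swap01).isZero = (d.bind s).isZero := by
    rintro (_ | _ | _ | _) <;> rfl
  simp only [Proc.numZero, delays_ren, delays_snu, countP_map_delays, h]

theorem numZero_snu_ren_swap01 (hD : D.WellFormed) (r : Rate) (P : Proc ar) :
    (Proc.snu r (P.ren id swap01)).numZero hD = P.numZero hD := by
  have h : ∀ d : Delay, ((d.ren swap01).bind r).isZero = d.isZero := by
    rintro (_ | _ | _ | _) <;> rfl
  rw [Proc.numZero, delays_snu, delays_ren, Multiset.map_map, Prod.map_comp_map,
    countP_map_delays]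
  simp only [Function.comp_apply, h, Proc.numZero]

/-- Every stochastic binder that is not in the scope of a prefix binds at most one unguarded
delay. -/
def Proc.Linear (hD : D.WellFormed) : Proc ar → Prop
  | .sum _ => True
  | .par P Q => P.Linear hD ∧ Q.Linear hD
  | .nu P => P.Linear hD
  | .snu _ P => P.Linear hD ∧ P.numZero hD ≤ 1
  | .call _ _ => True

theorem Proc.IsPlain.linear (hD : D.WellFormed) : (P : Proc ar) → P.IsPlain → P.Linear hD
  | .sum _, _ => trivial
  | .par P Q, h => ⟨Proc.IsPlain.linear hD P h.1, Proc.IsPlain.linear hD Q h.2⟩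
  | .nu P, h => Proc.IsPlain.linear hD P h
  | .snu _ _, h => h.elim
  | .call _ _, _ => trivial

theorem linear_ren (hD : D.WellFormed) : (P : Proc ar) →
    ∀ f g, (P.ren f g).Linear hD ↔ P.Linear hD
  | .sum _ => fun _ _ => Iff.rfl
  | .par P Q => fun f g => and_congr (linear_ren hD P f g) (linear_ren hD Q f g)
  | .nu P => fun _ g => linear_ren hD P _ g
  | .snu _ P => fun f g => by
    simp only [Proc.ren, Proc.Linear, linear_ren hD P, numZero_ren_lift]
  | .call _ _ => fun _ _ => Iff.rfl

/-- The count at a binder depends only on the delays of its body, which are invariant. Extrusion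
brings in no new bound delay, unfolding inserts a plain body, and the law for Markovian delays
creates a binder of exactly one. Terms under prefixes are not inspected. -/
theorem Cong.linear_iff (hD : D.WellFormed) {P Q : Proc ar} (h : Cong D P Q) :
    P.Linear hD ↔ Q.Linear hD := by
  induction h with
  | refl => exact Iff.rfl
  | symm _ ih => exact ih.symm
  | trans _ _ ih1 ih2 => exact ih1.trans ih2
  | par _ _ ih1 ih2 => exact and_congr ih1 ih2
  | nu _ ih => exact ih
  | snu _ h ih => simp only [Proc.Linear, Proc.numZero, ih, h.delays_eq hD]
  | pre | add | add_assoc | add_comm | add_nil => exact Iff.rfl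
  | nu_par P Q => simp only [Proc.Linear, Proc.up, linear_ren]
  | snu_par r P Q =>
    simp only [Proc.Linear, numZero_par, numZero_sup, Nat.add_zero]
    simp only [Proc.sup, linear_ren]
    exact and_right_comm
  | nu_nu P => simp only [Proc.Linear, linear_ren]
  | nu_snu r P => simp only [Proc.Linear, numZero_nu]
  | snu_snu r s P =>
    simp only [Proc.Linear, linear_ren, numZero_ren_swap01 hD s, numZero_snu_ren_swap01]
    exact and_right_comm
  | nu_nil => exact Iff.rfl
  | snu_nil => simp [Proc.nil, Proc.Linear, Proc.numZero, GSum.delays]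
  | par_assoc => exact _root_.and_assoc
  | par_comm => exact _root_.and_comm
  | par_nil => exact and_iff_left trivial
  | unfold A y =>
    exact iff_of_true trivial ((linear_ren hD _ _ _).2 (Proc.IsPlain.linear hD _ (hD.plain A)))
  | rate r P M =>
    refine iff_of_true trivial ⟨trivial, ?_⟩
    -- The weakened `M` does not mention the new name, so only the leading prefix can count.
    have h : M.sup.delays D = (Proc.sup (.sum M)).delays hD := (delays_sum hD _).symm
    have h0 := numZero_sup hD (.sum M)
    rw [Proc.numZero, ← h] at h0
    rw [Proc.numZero, delays_sum, GSum.delays, Multiset.countP_add, h0]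
    exact Multiset.countP_le_card (fun x : Delay × Cls D => x.1.isZero = true)
      {(Delay.sto 0, cls D P.sup)}

/-! ### Rate distributions -/

/-- The rate and target of a delay that carries a rate. -/
def rated : Delay × Cls D → Option (Rate × Cls D)
  | (.rate r, C) => some (r, C)
  | _ => none

/-- The hypothesis excludes the only label that `Delay.bind` turns from a name into a rate. -/
theorem filterMap_rated_map_bind (r : Rate) (m : Multiset (Delay × Cls D))
    (h : ∀ x ∈ m, ¬ x.1.isZero) :
    (m.map (Prod.map (Delay.bind r) (Cls.snu r))).filterMap rated =
      (m.filterMap rated).map fun p => (p.1, Cls.snu r p.2) := by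
  rw [Multiset.filterMap_map, Multiset.map_filterMap]
  induction m using Multiset.induction_on with
  | empty => rfl
  | cons x m ih =>
    replace ih := ih fun y hy => h y (Multiset.mem_cons_of_mem hy)
    obtain ⟨s | _ | q, C⟩ := x
    · rw [Multiset.filterMap_cons_some (b := (s, Cls.snu r C))
          (rated ∘ Prod.map (Delay.bind r) (Cls.snu r)) _ m rfl, ih]
      exact (Multiset.filterMap_cons_some
        (fun x => (rated x).map fun p => (p.1, Cls.snu r p.2)) (Delay.rate s, C) m rfl).symm
    · exact (h _ (Multiset.mem_cons_self _ _) rfl).elim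
    · rw [Multiset.filterMap_cons_none _ _ rfl, Multiset.filterMap_cons_none _ _ rfl, ih]

/-- If a stochastic binder binds at most one delay and this delay can elapse, then it contributes
exactly one rated delay. -/
theorem filterMap_rated_snu (hD : D.WellFormed) (r : Rate) {P P' : Proc ar}
    (hP : P.numZero hD ≤ 1) (h : Red D P (some 0) P') :
    ((Proc.snu r P).delays hD).filterMap rated =
      ((P.delays hD).filterMap rated).map (fun p => (p.1, Cls.snu r p.2)) +
        {(r, cls D (.snu r P'))} := by
  -- The reduction to `P'` accounts for one delay on the bound name. By linearity the remaining
  -- delays `m` contain no other.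
  obtain ⟨m, hm⟩ := Multiset.exists_cons_of_mem (h.mem_delays hD 0 rfl)
  rw [Proc.numZero, hm,
    Multiset.countP_cons_of_pos (p := fun x : Delay × Cls D => x.1.isZero = true) _ rfl] at hP
  have h0 : ∀ x ∈ m, ¬ x.1.isZero := Multiset.countP_eq_zero.1 (by omega)
  rw [delays_snu, hm, Multiset.map_cons,
    Multiset.filterMap_cons_some rated _ _ (b := (r, cls D (.snu r P'))) rfl,
    Multiset.filterMap_cons_none _ _ rfl, filterMap_rated_map_bind r m h0, add_comm,
    Multiset.singleton_add]

theorem filterMap_rated_eq_zero (hD : D.WellFormed) {P : Proc ar} (h : ¬ Enabled D P) :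
    (P.delays hD).filterMap rated = 0 := by
  refine Multiset.eq_zero_of_forall_notMem fun x hx => h ?_
  obtain ⟨⟨_ | _, C⟩, hd, he⟩ := (Multiset.mem_filterMap _ _).1 hx
  · exact .of_mem_delays hD hd
  · cases he

/-- The rate distribution of a linear term consists of its delays that carry a rate. -/
theorem StoStep.eq_filterMap_rated (hD : D.WellFormed) {P : Proc ar} {σ : RDist (Cls D)}
    (h : StoStep D {P | ¬ Enabled D P} P σ) :
    P.Linear hD → σ.1 = (P.delays hD).filterMap rated := by
  induction h with
  | sto1 r _ hr ih =>
    intro hl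
    rw [filterMap_rated_snu hD r hl.2 hr, ← ih hl.1]
    rfl
  | sto2 r hP hr =>
    intro hl
    -- The body is not enabled, so the newly bound delay is the only rated one.
    rw [filterMap_rated_snu hD r hl.2 hr, filterMap_rated_eq_zero hD hP]
    rfl
  | cong hc _ ih =>
    intro hl
    rw [hc.delays_eq hD]
    exact ih ((hc.linear_iff hD).1 hl)

end MarkovPi

theorem proposition8 {K : Type*} (ar : K → ℕ) (D : MarkovPi.Env ar) (hD : D.WellFormed)
    (P : MarkovPi.Proc ar) (hP : P.IsPlain) (σ σ' : MarkovPi.RDist (MarkovPi.Cls D))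
    (hσ : MarkovPi.StoTrans D P σ) (hσ' : MarkovPi.StoTrans D P σ') : σ = σ' := by
  -- The negative premise now reads as the absence of an enabled top-level binder.
  rw [MarkovPi.StoTrans, MarkovPi.refuted_eq hD] at hσ hσ'
  have hl := MarkovPi.Proc.IsPlain.linear hD P hP
  exact Subtype.ext
    ((hσ.eq_filterMap_rated hD hl).trans (hσ'.eq_filterMap_rated hD hl).symm)
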